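/- Let $\mathcal{L}_{OG,\sigma}=\{+,-,0,<,\sigma\}$ be the first-order language of ordered groups expanded by a unary function symbol $\sigma$. Let $\mathrm{ODAG}^+_\sigma$ be the $\mathcal{L}_{OG,\sigma}$-theory whose models are the nontrivial divisible (totally) ordered abelian groups together with an automorphism $\sigma$ of the ordered group such that $x<\sigma(x)$ for every $x>0$. Then $\mathrm{ODAG}^+_\sigma$ has no model companion in $\mathcal{L}_{OG,\sigma}$. That is, there is no $\mathcal{L}_{OG,\sigma}$-theory $T'$ such that $T'$ is model complete (every embedding between models of $T'$ is elementary), every model of $\mathrm{ODAG}^+_\sigma$ embeds into a model of $T'$, and every model of $T'$ embeds into a model of $\mathrm{ODAG}^+_\sigma$. -/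

import Mathlib

namespace FirstOrder.Language.Theory

universe u v

variable {L : Language.{u, v}}

/-- A theory is model complete if every embedding between two of its models is elementary.
(Models are taken in `Type (max u v)`, which suffices by the Löwenheim–Skolem theorems.) -/
def IsModelComplete (T : L.Theory) : Prop :=
  ∀ (M N : ModelType.{u, v, max u v} T) (f : M ↪[L] N) (n : ℕ) (φ : L.Formula (Fin n))
    (x : Fin n → M), φ.Realize (f ∘ x) ↔ φ.Realize x

/-- `T'` is a model companion of `T` (in the same language): `T'` is model complete, every model
of `T` embeds into a model of `T'`, and every model of `T'` embeds into a model of `T`. -/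
structure IsModelCompanionOf (T' T : L.Theory) : Prop where
  isModelComplete : T'.IsModelComplete
  embeds_into : ∀ M : ModelType.{u, v, max u v} T,
    ∃ N : ModelType.{u, v, max u v} T', Nonempty (M ↪[L] N)
  embeds_back : ∀ N : ModelType.{u, v, max u v} T',
    ∃ M : ModelType.{u, v, max u v} T, Nonempty (N ↪[L] M)

end FirstOrder.Language.Theory

namespace OrderedDifferenceGroup

open FirstOrder FirstOrder.Language

/-- The function symbols `+`, `-` (unary), `0` and `σ`. -/
inductive Func : ℕ → Type
  | add : Func 2
  | neg : Func 1
  | zero : Func 0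
  | sigma : Func 1

/-- The only relation symbol is the binary symbol `<`. -/
inductive Rel : ℕ → Type
  | lt : Rel 2

/-- The language `{+, -, 0, <, σ}` of ordered groups with an added unary function symbol `σ`. -/
def langOGσ : Language where
  Functions := Func
  Relations := Rel

/-- The symbol `+`. -/
abbrev addFunc : langOGσ.Functions 2 := Func.add

/-- The symbol `-`. -/
abbrev negFunc : langOGσ.Functions 1 := Func.neg

/-- The symbol `0`. -/
abbrev zeroFunc : langOGσ.Constants := Func.zero

/-- The symbol `σ`. -/
abbrev sigmaFunc : langOGσ.Functions 1 := Func.sigma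

/-- The symbol `<`. -/
abbrev ltRel : langOGσ.Relations 2 := Rel.lt

section Terms

variable {α : Type}

/-- The term `s + t`. -/
def add (s t : langOGσ.Term α) : langOGσ.Term α :=
  addFunc.apply₂ s t

/-- The term `-t`. -/
def neg (t : langOGσ.Term α) : langOGσ.Term α :=
  negFunc.apply₁ t

/-- The term `0`. -/
def zero : langOGσ.Term α :=
  zeroFunc.term

/-- The term `σ(t)`. -/
def sigma (t : langOGσ.Term α) : langOGσ.Term α :=
  sigmaFunc.apply₁ t

/-- The term `n t = 0 + t + ⋯ + t` (with `n` summands `t`). -/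
def nsmul : ℕ → langOGσ.Term α → langOGσ.Term α
  | 0, _ => zero
  | n + 1, t => add (nsmul n t) t

/-- The atomic formula `s < t`. -/
def lt {n : ℕ} (s t : langOGσ.Term (α ⊕ Fin n)) : langOGσ.BoundedFormula α n :=
  ltRel.boundedFormula₂ s t

end Terms

/-- Names for the axioms of nontrivial ordered divisible abelian groups with an automorphism that
is increasing on the positive elements. -/
inductive Axiom : Type
  | addAssoc | addComm | addZero | addNeg
  | ltIrrefl | ltTrans | ltTotal | addLtAdd
  | divisible (n : ℕ)
  | nontrivial
  | sigmaInjective | sigmaSurjective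
  | sigmaAdd | sigmaNeg | sigmaZero | sigmaLt
  | sigmaIncreasing

/-- The sentence expressing an axiom. -/
def Axiom.toSentence : Axiom → langOGσ.Sentence
  | .addAssoc => ∀' ∀' ∀' (add (add &0 &1) &2 =' add &0 (add &1 &2))
  | .addComm => ∀' ∀' (add &0 &1 =' add &1 &0)
  | .addZero => ∀' (add &0 zero =' &0)
  | .addNeg => ∀' (add &0 (neg &0) =' zero)
  | .ltIrrefl => ∀' ∼(lt &0 &0)
  | .ltTrans => ∀' ∀' ∀' (lt &0 &1 ⟹ lt &1 &2 ⟹ lt &0 &2)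
  | .ltTotal => ∀' ∀' (lt &0 &1 ⊔ ((&0 =' &1) ⊔ lt &1 &0))
  | .addLtAdd => ∀' ∀' ∀' (lt &0 &1 ⟹ lt (add &0 &2) (add &1 &2))
  | .divisible n => ∀' ∃' (nsmul (n + 1) &1 =' &0)
  | .nontrivial => ∃' ∼(&0 =' zero)
  | .sigmaInjective => ∀' ∀' ((sigma &0 =' sigma &1) ⟹ (&0 =' &1))
  | .sigmaSurjective => ∀' ∃' (sigma &1 =' &0)
  | .sigmaAdd => ∀' ∀' (sigma (add &0 &1) =' add (sigma &0) (sigma &1))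
  | .sigmaNeg => ∀' (sigma (neg &0) =' neg (sigma &0))
  | .sigmaZero => sigma zero =' zero
  | .sigmaLt => ∀' ∀' (lt &0 &1 ⇔ lt (sigma &0) (sigma &1))
  | .sigmaIncreasing => ∀' (lt zero &0 ⟹ lt &0 (sigma &0))

/-- The theory `ODAG⁺_σ` of (nontrivial) ordered divisible abelian groups with an automorphism
`σ` such that `x < σ(x)` for all `x > 0`. -/
def odagσPlus : langOGσ.Theory :=
  Set.range Axiom.toSentence

end OrderedDifferenceGroup

namespace OrderedDifferenceGroup

open FirstOrder FirstOrder.Language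

/-! The obstruction is the condition that some `x` with `σ x = 2x` lies between `a` and `b`. For `0
< a` and `2b < σ b`, it can be forced in an extension as soon as `σ^n a < b` for all `n`
(`exists_double_between`). In `ℚ` with `σ x = 4x` it fails for `a = 1`, `b = 4 ^ n`, even after
extension (`not_double_between`): `x` would have to exceed `2 ^ k` for every `k`.

Given a model companion `T`, embed this `ℚ` in a model of `T` and take an ultrapower, with `a` the
class of `1` and `b` the class of `n ↦ 4 ^ n`. By Łoś, no such `x` exists there although `b` lies
above every `σ^k a`. Some extension modelling `T` does contain one, contradicting model
completeness. -/

/-- The interpretation of the language of ordered difference groups in an abelian group `G` with a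
set of positive elements and a self-map. -/
@[reducible] def structureOf {G : Type} [AddCommGroup G] (Pos : G → Prop) (σ : G → G) :
    langOGσ.Structure G where
  funMap := fun {_} f => match f with
    | Func.add => fun v => v 0 + v 1
    | Func.neg => fun v => -v 0
    | Func.zero => fun _ => 0
    | Func.sigma => fun v => σ (v 0)
  RelMap := fun {_} r => match r with
    | Rel.lt => fun v => Pos (v 1 - v 0)

/-! ### Interpreted symbols and their preservation under embeddings -/

section Interpretation

variable {M : Type} [langOGσ.Structure M]

/-- The interpretation of `+`. -/
def iAdd (x y : M) : M := Structure.funMap addFunc ![x, y]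

/-- The interpretation of `-`. -/
def iNeg (x : M) : M := Structure.funMap negFunc ![x]

/-- The interpretation of `0`. -/
def iZero : M := (zeroFunc : M)

/-- The interpretation of `σ`. -/
def iSigma (x : M) : M := Structure.funMap sigmaFunc ![x]

/-- The interpretation of `<`. -/
def iLt (x y : M) : Prop := Structure.RelMap ltRel ![x, y]

variable {α : Type} (v : α → M)

@[simp] theorem realize_add (s t : langOGσ.Term α) :
    (add s t).realize v = iAdd (s.realize v) (t.realize v) :=
  Term.realize_functions_apply₂

@[simp] theorem realize_neg (t : langOGσ.Term α) : (neg t).realize v = iNeg (t.realize v) :=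
  Term.realize_functions_apply₁

@[simp] theorem realize_zero : (zero : langOGσ.Term α).realize v = iZero :=
  Term.realize_constants

@[simp] theorem realize_sigma (t : langOGσ.Term α) : (sigma t).realize v = iSigma (t.realize v) :=
  Term.realize_functions_apply₁

@[simp] theorem realize_nsmul_zero (t : langOGσ.Term α) :
    (nsmul 0 t).realize v = iZero :=
  realize_zero v

@[simp] theorem realize_nsmul_succ (n : ℕ) (t : langOGσ.Term α) :
    (nsmul (n + 1) t).realize v = iAdd ((nsmul n t).realize v) (t.realize v) :=
  realize_add v _ _

@[simp] theorem realize_lt {n : ℕ} (w : Fin n → M) (s t : langOGσ.Term (α ⊕ Fin n)) :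
    (lt s t).Realize v w ↔ iLt (s.realize (Sum.elim v w)) (t.realize (Sum.elim v w)) :=
  BoundedFormula.realize_rel₂

variable {N : Type} [langOGσ.Structure N] (f : M ↪[langOGσ] N)

theorem map_iAdd (x y : M) : f (iAdd x y) = iAdd (f x) (f y) := by
  simp only [iAdd, f.map_fun]
  congr 1
  ext i; fin_cases i <;> rfl

theorem map_iZero : f iZero = iZero := f.map_constants _

theorem map_iSigma (x : M) : f (iSigma x) = iSigma (f x) := by
  simp only [iSigma, f.map_fun]
  congr 1
  ext i; fin_cases i; rfl

theorem map_iLt (x y : M) : iLt (f x) (f y) ↔ iLt x y := by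
  rw [iLt, iLt, ← f.map_rel]
  congr! 1
  ext i; fin_cases i <;> rfl

end Interpretation

/-- Working with a positive cone instead of an order instance lets this serve both `ℚ` and `G × ℚ`,
whose order here is not the product order. -/
theorem model_structureOf {G : Type} [AddCommGroup G] [Nontrivial G] {Pos : G → Prop} {σ : G →+ G}
    (hdiv : ∀ (n : ℕ) (x : G), ∃ y, (n + 1) • y = x)
    (hzero : ¬ Pos 0) (hadd : ∀ x y, Pos x → Pos y → Pos (x + y))
    (htotal : ∀ x, Pos x ∨ x = 0 ∨ Pos (-x))
    (hσ : Function.Bijective σ) (hpos : ∀ x, Pos (σ x) ↔ Pos x) (hinc : ∀ x, Pos x → Pos (σ x - x)) :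
    letI := structureOf Pos σ
    G ⊨ odagσPlus := by
  let _ := structureOf Pos σ
  have iadd (x y : G) : iAdd x y = x + y := rfl
  have ineg (x : G) : iNeg x = -x := rfl
  have izero : (iZero : G) = 0 := rfl
  have isig (x : G) : iSigma x = σ x := rfl
  have ilt (x y : G) : iLt x y ↔ Pos (y - x) := Iff.rfl
  have ins {α : Type} (v : α → G) (n : ℕ) (t : langOGσ.Term α) :
      (nsmul n t).realize v = n • t.realize v := by
    induction n with
    | zero => simp [izero]
    | succ n ih => rw [realize_nsmul_succ, ih, iadd, succ_nsmul]
  refine ⟨?_⟩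
  rintro _ ⟨a, rfl⟩
  cases a <;> simp [Axiom.toSentence, Sentence.Realize, Formula.Realize, Fin.snoc, iadd,
    ineg, izero, isig, ilt, ins, -realize_nsmul_succ]
  case addAssoc => exact add_assoc
  case addComm => exact add_comm
  case ltIrrefl => exact hzero
  case ltTrans => exact fun x y z hxy hyz => by simpa using hadd _ _ hyz hxy
  case ltTotal =>
    intro x y
    have := htotal (y - x)
    rwa [sub_eq_zero, neg_sub, eq_comm (a := y)] at this
  case divisible n => exact hdiv n
  case nontrivial => exact exists_ne 0
  case sigmaInjective => exact fun x y h => hσ.injective h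
  case sigmaSurjective => exact hσ.surjective
  case sigmaLt => exact fun x y => by rw [← map_sub, hpos]
  case sigmaIncreasing => exact hinc

/-! ### Models as ordered groups -/

section Model

variable (M : Type) [langOGσ.Structure M] [M ⊨ odagσPlus]

theorem realize_axiom (a : Axiom) : M ⊨ a.toSentence :=
  Theory.realize_sentence_of_mem odagσPlus (Set.mem_range_self a)

theorem exists_orderedGroup : ∃ (_ : AddCommGroup M) (_ : LinearOrder M) (_ : IsOrderedAddMonoid M)
    (σ : M →+ M), (∀ x y : M, iAdd x y = x + y) ∧ (∀ x : M, iNeg x = -x) ∧ (iZero : M) = 0 ∧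
      (∀ x, iSigma x = σ x) ∧ (∀ x y : M, iLt x y ↔ x < y) ∧
      (∀ (n : ℕ) (x : M), ∃ y, (n + 1) • y = x) ∧ Function.Surjective σ ∧ StrictMono σ ∧
      ∀ x, 0 < x → x < σ x := by
  classical
  have addAssoc := realize_axiom M .addAssoc
  have addComm := realize_axiom M .addComm
  have addZero := realize_axiom M .addZero
  have addNeg := realize_axiom M .addNeg
  have ltIrrefl := realize_axiom M .ltIrrefl
  have ltTrans := realize_axiom M .ltTrans
  have ltTotal := realize_axiom M .ltTotal
  have addLtAdd := realize_axiom M .addLtAdd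
  have divisible n := realize_axiom M (.divisible n)
  have sigmaSurjective := realize_axiom M .sigmaSurjective
  have sigmaAdd := realize_axiom M .sigmaAdd
  have sigmaZero := realize_axiom M .sigmaZero
  have sigmaLt := realize_axiom M .sigmaLt
  have sigmaIncreasing := realize_axiom M .sigmaIncreasing
  simp [Axiom.toSentence, Sentence.Realize, Formula.Realize, Fin.snoc]
    at addAssoc addComm addZero addNeg ltIrrefl ltTrans ltTotal addLtAdd
  simp [Axiom.toSentence, Sentence.Realize, Formula.Realize, Fin.snoc, -realize_nsmul_succ]
    at divisible sigmaSurjective sigmaAdd sigmaZero sigmaLt sigmaIncreasing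
  let _ : Add M := ⟨iAdd⟩
  let _ : Zero M := ⟨iZero⟩
  let _ : Neg M := ⟨iNeg⟩
  let group : AddCommGroup M :=
    { AddGroup.ofLeftAxioms addAssoc (fun x => (addComm _ _).trans (addZero x))
        (fun x => (addComm _ _).trans (addNeg x)) with
      add_comm := addComm }
  let order : LinearOrder M :=
    { lt := iLt
      le := fun x y => iLt x y ∨ x = y
      le_refl := fun x => Or.inr rfl
      le_trans := by
        rintro x y z (h | rfl) (h' | rfl)
        · exact Or.inl (ltTrans _ _ _ h h')
        · exact Or.inl h
        · exact Or.inl h'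
        · exact Or.inr rfl
      le_antisymm := by
        rintro x y (h | rfl) (h' | h')
        · exact absurd (ltTrans _ _ _ h h') (ltIrrefl x)
        · exact h'.symm
        · rfl
        · rfl
      lt_iff_le_not_ge := by
        intro x y
        refine ⟨fun h => ⟨Or.inl h, ?_⟩, ?_⟩
        · rintro (h' | rfl)
          · exact ltIrrefl _ (ltTrans _ _ _ h h')
          · exact ltIrrefl _ h
        · rintro ⟨h | rfl, h'⟩
          · exact h
          · exact absurd (Or.inr rfl) h'
      le_total := by
        intro x y
        rcases ltTotal x y with h | rfl | h
        · exact Or.inl (Or.inl h)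
        · exact Or.inl (Or.inr rfl)
        · exact Or.inr (Or.inl h)
      toDecidableLE := Classical.decRel _ }
  have hnsmul {α : Type} (v : α → M) (n : ℕ) (t : langOGσ.Term α) :
      (nsmul n t).realize v = n • t.realize v := by
    induction n with
    | zero => rw [realize_nsmul_zero, zero_smul]; rfl
    | succ n ih => rw [realize_nsmul_succ, ih, succ_nsmul]; rfl
  refine ⟨group, order, { add_le_add_left := ?_ }, ⟨⟨iSigma, sigmaZero⟩, sigmaAdd⟩,
    fun _ _ => rfl, fun _ => rfl, rfl, fun _ => rfl, fun _ _ => Iff.rfl, ?_, sigmaSurjective, fun x y => (sigmaLt x y).1,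
    sigmaIncreasing⟩
  · rintro x y (h | rfl) z
    · exact Or.inl (addLtAdd _ _ _ h)
    · exact Or.inr rfl
  · intro n x
    obtain ⟨y, hy⟩ := divisible n x
    rw [hnsmul] at hy
    exact ⟨y, hy⟩

end Model

/-! ### Adjoining an element doubled by the automorphism -/

section Extension

/-- The automorphism `σ` extended to `G × ℚ` by doubling on the second factor. -/
def extSigma {G : Type} [AddCommGroup G] (σ : G →+ G) : G × ℚ →+ G × ℚ :=
  σ.prodMap (AddMonoidHom.mulLeft 2)

theorem extSigma_mk {G : Type} [AddCommGroup G] (σ : G →+ G) (m : G) (k : ℚ) :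
    extSigma σ (m, k) = (σ m, 2 * k) := rfl

variable {G : Type} [AddCommGroup G] [LinearOrder G] (σ : G →+ G) (b : G)

/-- An element all of whose iterates under `σ` lie strictly between `-b` and `b`. -/
def IsSmall (m : G) : Prop := ∀ n : ℕ, -b < σ^[n] m ∧ σ^[n] m < b

/-- The positive elements of `G × ℚ` for the order which places the second factor just above the
convex subgroup of small elements of `G`. -/
def ExtPos (p : G × ℚ) : Prop :=
  (¬ IsSmall σ b p.1 ∧ 0 < p.1) ∨ (IsSmall σ b p.1 ∧ (0 < p.2 ∨ p.2 = 0 ∧ 0 < p.1))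

variable {σ b} [IsOrderedAddMonoid G]

theorem IsSmall.neg {m : G} (h : IsSmall σ b m) : IsSmall σ b (-m) := fun n => by
  rw [iterate_map_neg]
  exact ⟨neg_lt_neg (h n).2, neg_lt.1 (h n).1⟩

theorem isSmall_neg_iff {m : G} : IsSmall σ b (-m) ↔ IsSmall σ b m :=
  ⟨fun h => by simpa using h.neg, IsSmall.neg⟩

theorem isSmall_zero (hb : 0 < b) : IsSmall σ b 0 := fun n => by
  simpa [iterate_map_zero] using hb

theorem IsSmall.of_le (hσ : StrictMono σ) (hb : 0 < b) {m y : G} (h : IsSmall σ b m) (hy : 0 ≤ y)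
    (hym : y ≤ m) : IsSmall σ b y := fun n => by
  have h0 := (hσ.iterate n).monotone hy
  rw [iterate_map_zero] at h0
  exact ⟨(neg_lt_zero.2 hb).trans_le h0, ((hσ.iterate n).monotone hym).trans_lt (h n).2⟩

/-- Bound the iterates one step further on: their sum is below `2b ≤ σ b`, and one `σ` can then be
cancelled. This is where the doubling hypothesis on `b` makes the small elements a subgroup. -/
theorem IsSmall.add (hσ : StrictMono σ) (hbσ : b + b ≤ σ b) {m m' : G} (h : IsSmall σ b m)
    (h' : IsSmall σ b m') : IsSmall σ b (m + m') := fun n => by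
  have h1 := h (n + 1)
  have h1' := h' (n + 1)
  rw [Function.iterate_succ_apply'] at h1 h1'
  rw [iterate_map_add]
  constructor <;> rw [← hσ.lt_iff_lt] <;> simp only [map_add, map_neg]
  · calc -σ b ≤ -(b + b) := neg_le_neg hbσ
      _ = -b + -b := neg_add _ _
      _ < _ := add_lt_add h1.1 h1'.1
  · exact (add_lt_add h1.2 h1'.2).trans_le hbσ

theorem isSmall_add_iff (hσ : StrictMono σ) (hbσ : b + b ≤ σ b) {m m' : G} (h : IsSmall σ b m') :
    IsSmall σ b (m + m') ↔ IsSmall σ b m :=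
  ⟨fun h' => by simpa using h'.add hσ hbσ h.neg, fun h' => h'.add hσ hbσ h⟩

theorem isSmall_map_iff (hσ : StrictMono σ) (hb : 0 < b) (hinc : ∀ x, 0 < x → x < σ x) {m : G} :
    IsSmall σ b (σ m) ↔ IsSmall σ b m := by
  refine ⟨fun h n => ?_, fun h n => h (n + 1)⟩
  have h1 := h n
  rw [← Function.iterate_succ_apply, Function.iterate_succ_apply'] at h1
  have hbσ := hinc b hb
  constructor <;> rw [← hσ.lt_iff_lt]
  · rw [map_neg]
    exact (neg_lt_neg hbσ).trans h1.1
  · exact h1.2.trans hbσ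

/-- This makes `σ` strictly increasing on the quotient by the small elements. If an iterate `y` of
`m` were at least `b`, then `y - b ≤ σ (y - b)` would give `σ y - y ≥ σ b - b ≥ b`, so `σ m - m`
would not be small. -/
theorem not_isSmall_map_sub (hσ : StrictMono σ) (hb : 0 < b) (hbσ : b + b ≤ σ b)
    (hinc : ∀ x, 0 < x → x < σ x) {m : G} (hm : ¬ IsSmall σ b m) (h0 : 0 < m) :
    ¬ IsSmall σ b (σ m - m) := by
  contrapose! hm
  intro n
  have h0n := hσ.iterate n h0
  rw [iterate_map_zero] at h0n
  refine ⟨(neg_lt_zero.2 hb).trans h0n, lt_of_not_ge fun hle => ?_⟩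
  have h1 := (hm n).2
  rw [iterate_map_sub, ← Function.iterate_succ_apply, Function.iterate_succ_apply'] at h1
  set y := σ^[n] m
  have h2 : y - b ≤ σ (y - b) := by
    rcases hle.eq_or_lt with h | h
    · simp [← h]
    · exact (hinc _ (sub_pos.2 h)).le
  rw [map_sub] at h2
  grind

theorem extPos_add (hσ : StrictMono σ) (hb : 0 < b) (hbσ : b + b ≤ σ b) {p q : G × ℚ}
    (hp : ExtPos σ b p) (hq : ExtPos σ b q) : ExtPos σ b (p + q) := by
  obtain ⟨m, k⟩ := p
  obtain ⟨m', k'⟩ := q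
  -- By convexity, a small perturbation cannot change the sign of an element that is not small.
  have key {x y : G} (hx : ¬ IsSmall σ b x) (h0 : 0 < x) (hy : IsSmall σ b y) : 0 < x + y := by
    by_contra! h
    exact hx (hy.neg.of_le hσ hb h0.le (by grind))
  simp only [ExtPos, Prod.mk_add_mk] at *
  rcases hp with ⟨hm, h0⟩ | ⟨hm, h⟩ <;> rcases hq with ⟨hm', h0'⟩ | ⟨hm', h'⟩
  · exact Or.inl ⟨fun h => hm (h.of_le hσ hb h0.le (by grind)), add_pos h0 h0'⟩
  · exact Or.inl ⟨by rwa [isSmall_add_iff hσ hbσ hm'], key hm h0 hm'⟩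
  · rw [add_comm m m']
    exact Or.inl ⟨by rwa [isSmall_add_iff hσ hbσ hm], key hm' h0' hm⟩
  · refine Or.inr ⟨hm.add hσ hbσ hm', ?_⟩
    rcases h with h | ⟨h, h1⟩ <;> rcases h' with h' | ⟨h', h1'⟩
    · exact Or.inl (by linarith)
    · exact Or.inl (by linarith)
    · exact Or.inl (by linarith)
    · exact Or.inr ⟨by linarith, add_pos h1 h1'⟩

theorem extPos_total (hb : 0 < b) (p : G × ℚ) : ExtPos σ b p ∨ p = 0 ∨ ExtPos σ b (-p) := by
  obtain ⟨m, k⟩ := p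
  simp only [ExtPos, Prod.neg_mk, isSmall_neg_iff, Left.neg_pos_iff, neg_eq_zero,
    Prod.mk_eq_zero]
  have hz : m = 0 → IsSmall σ b m := fun h => h ▸ isSmall_zero hb
  rcases lt_trichotomy m 0 with h | h | h <;> rcases lt_trichotomy k 0 with h' | h' | h' <;>
    by_cases hs : IsSmall σ b m <;> simp_all

theorem extPos_extSigma_iff (hσ : StrictMono σ) (hb : 0 < b) (hinc : ∀ x, 0 < x → x < σ x)
    (p : G × ℚ) : ExtPos σ b (extSigma σ p) ↔ ExtPos σ b p := by
  obtain ⟨m, k⟩ := p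
  have h : 0 < σ m ↔ 0 < m := by simpa using hσ.lt_iff_lt (a := 0) (b := m)
  simp only [ExtPos, extSigma_mk, isSmall_map_iff hσ hb hinc, h]
  simp

theorem extPos_extSigma_sub (hσ : StrictMono σ) (hb : 0 < b) (hbσ : b + b ≤ σ b)
    (hinc : ∀ x, 0 < x → x < σ x) {p : G × ℚ} (hp : ExtPos σ b p) :
    ExtPos σ b (extSigma σ p - p) := by
  obtain ⟨m, k⟩ := p
  have h2 : 2 * k - k = k := by ring
  simp only [ExtPos, extSigma_mk, Prod.mk_sub_mk, h2, sub_pos] at *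
  rcases hp with ⟨hm, h0⟩ | ⟨hm, h⟩
  · exact Or.inl ⟨not_isSmall_map_sub hσ hb hbσ hinc hm h0, hinc m h0⟩
  · refine Or.inr ⟨?_, h.imp_right fun h => ⟨h.1, hinc m h.2⟩⟩
    rw [sub_eq_add_neg]
    exact ((isSmall_map_iff hσ hb hinc).2 hm).add hσ hbσ hm.neg

end Extension

/-- The witness is `(0, 1)` in `G × ℚ`: it lies above all small elements, among them `a`, and below
the positive elements that are not small, among them `b`. -/
theorem exists_double_between (N : odagσPlus.ModelType) (a b : N) (ha : iLt iZero a)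
    (hbσ : iLt (iAdd b b) (iSigma b)) (hab : ∀ n : ℕ, iLt (iSigma^[n] a) b) :
    ∃ (N' : odagσPlus.ModelType) (f : N ↪[langOGσ] N') (x : N'),
      iLt (f a) x ∧ iLt x (f b) ∧ iSigma x = iAdd x x := by
  obtain ⟨_, _, _, σ, iadd, ineg, izero, isig, ilt, hdiv, hsurj, hσ, hinc⟩ := exists_orderedGroup N
  have hiter (n : ℕ) : iSigma^[n] a = σ^[n] a := by rw [funext isig]
  simp only [iadd, izero, isig, ilt, hiter] at ha hbσ hab
  have hb : 0 < b := ha.trans (hab 0)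
  have hsmall : IsSmall σ b a := fun n => by
    have := hσ.iterate n ha
    rw [iterate_map_zero] at this
    exact ⟨(neg_lt_zero.2 hb).trans this, hab n⟩
  have hnot : ¬ IsSmall σ b b := fun h => lt_irrefl _ (h 0).2
  let _ := structureOf (ExtPos σ b) (extSigma σ)
  have : (N × ℚ) ⊨ odagσPlus := by
    apply model_structureOf
    · rintro n ⟨m, k⟩
      obtain ⟨y, rfl⟩ := hdiv n m
      refine ⟨(y, k / (n + 1)), Prod.ext rfl ?_⟩
      simp only [Prod.smul_mk, nsmul_eq_mul]
      push_cast
      field_simp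
    · simp [ExtPos]
    · exact fun x y => extPos_add hσ hb hbσ.le
    · exact extPos_total hb
    · exact Function.Bijective.prodMap ⟨hσ.injective, hsurj⟩
        ⟨mul_right_injective₀ two_ne_zero, mul_left_surjective₀ two_ne_zero⟩
    · exact extPos_extSigma_iff hσ hb hinc
    · exact fun x => extPos_extSigma_sub hσ hb hbσ.le hinc
  refine ⟨Theory.ModelType.of _ (N × ℚ), ⟨⟨fun m => (m, 0), fun m m' h => congrArg Prod.fst h⟩, ?_,
    ?_⟩, (0, 1), ?_, ?_, ?_⟩
  · rintro n (_ | _ | _ | _) v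
    · have hv : v = ![v 0, v 1] := by ext i; fin_cases i <;> rfl
      exact Prod.ext ((congrArg (Structure.funMap addFunc) hv).trans (iadd (v 0) (v 1)))
        (add_zero 0).symm
    · have hv : v = ![v 0] := by ext i; fin_cases i; rfl
      exact Prod.ext ((congrArg (Structure.funMap negFunc) hv).trans (ineg (v 0))) neg_zero.symm
    · have hv : v = default := Subsingleton.elim _ _
      exact Prod.ext ((congrArg (Structure.funMap zeroFunc) hv).trans izero) rfl
    · have hv : v = ![v 0] := by ext i; fin_cases i; rfl
      exact Prod.ext ((congrArg (Structure.funMap sigmaFunc) hv).trans (isig (v 0)))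
        (mul_zero 2).symm
  · rintro n (_ | _) v
    have hv : v = ![v 0, v 1] := by ext i; fin_cases i <;> rfl
    refine Iff.trans ?_ ((ilt (v 0) (v 1)).symm.trans (by rw [iLt, ← hv]))
    show ExtPos σ b ((v 1, 0) - (v 0, 0)) ↔ v 0 < v 1
    simp [ExtPos, ← or_and_right, em']
  -- The first coordinate `-a` is small, so the sign is that of the second coordinate.
  · show ExtPos σ b ((0, 1) - (a, 0))
    simp [ExtPos, isSmall_neg_iff, hsmall]
  · show ExtPos σ b ((b, 0) - (0, 1))
    simp [ExtPos, hnot, hb]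
  · show extSigma σ (0, 1) = (0, 1) + (0, 1)
    rw [extSigma_mk]
    norm_num

/-! ### The formulas transferred by Łoś's theorem -/

/-- The formula expressing that some `x` with `σ(x) = 2x` lies between the two variables. -/
def doubleBetween : langOGσ.Formula (Fin 2) :=
  ∃' ((lt (Term.var (Sum.inl 0)) &0 ⊓ lt &0 (Term.var (Sum.inl 1))) ⊓
    (sigma &0 =' add &0 &0))

theorem realize_doubleBetween {M : Type} [langOGσ.Structure M] (v : Fin 2 → M) :
    doubleBetween.Realize v ↔ ∃ x, iLt (v 0) x ∧ iLt x (v 1) ∧ iSigma x = iAdd x x := by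
  simp [doubleBetween, Formula.Realize, Fin.snoc, and_assoc]

/-- The formula expressing that the `n`-th iterate of `σ` at the first variable is below the
second variable. -/
def iterateLt (n : ℕ) : langOGσ.Formula (Fin 2) :=
  lt (sigma^[n] (Term.var (Sum.inl 0))) (Term.var (Sum.inl 1))

theorem realize_iterateLt {M : Type} [langOGσ.Structure M] (n : ℕ) (v : Fin 2 → M) :
    (iterateLt n).Realize v ↔ iLt (iSigma^[n] (v 0)) (v 1) := by
  have h {α : Type} (w : α → M) (t : langOGσ.Term α) :
      (sigma^[n] t).realize w = iSigma^[n] (t.realize w) := by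
    induction n generalizing t with
    | zero => rfl
    | succ n ih => rw [Function.iterate_succ_apply, ih, realize_sigma, Function.iterate_succ_apply]
  simp [iterateLt, Formula.Realize, h]

/-- The formula expressing that the first variable is positive and that the second one is more than
doubled by `σ`. -/
def posAndDoubled : langOGσ.Formula (Fin 2) :=
  lt zero (Term.var (Sum.inl 0)) ⊓
    lt (add (Term.var (Sum.inl 1)) (Term.var (Sum.inl 1))) (sigma (Term.var (Sum.inl 1)))

theorem realize_posAndDoubled {M : Type} [langOGσ.Structure M] (v : Fin 2 → M) :
    posAndDoubled.Realize v ↔ iLt iZero (v 0) ∧ iLt (iAdd (v 1) (v 1)) (iSigma (v 1)) := by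
  simp [posAndDoubled, Formula.Realize]

/-! ### The rational model and the contradiction -/

/-- The rational numbers with multiplication by four. -/
instance ratStructure : langOGσ.Structure ℚ :=
  structureOf (0 < ·) (4 * ·)

instance model_rat : Theory.Model ℚ odagσPlus := by
  apply model_structureOf (σ := AddMonoidHom.mulLeft (4 : ℚ))
  · intro n x
    refine ⟨x / (n + 1), ?_⟩
    rw [nsmul_eq_mul]
    push_cast
    field_simp
  · simp
  · exact fun x y => add_pos
  · intro x
    rcases lt_trichotomy x 0 with h | h | h <;> simp [h]
  · exact ⟨mul_right_injective₀ four_ne_zero, mul_left_surjective₀ four_ne_zero⟩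
  · simp
  · intro x hx
    simp only [AddMonoidHom.coe_mulLeft]
    linarith

theorem not_double_between (N : odagσPlus.ModelType.{0, 0, 0}) (f : ℚ ↪[langOGσ] N) (n : ℕ)
    (x : N) (h0 : iLt (f 1) x) (h1 : iLt x (f (4 ^ n))) (hx : iSigma x = iAdd x x) :
    False := by
  obtain ⟨_, _, _, σ, iadd, ineg, izero, isig, ilt, hdiv, hsurj, hσ, hinc⟩ := exists_orderedGroup N
  simp only [iadd, isig, ilt] at h0 h1 hx
  have hadd (p q : ℚ) : f (p + q) = f p + f q := by
    rw [← iadd, ← map_iAdd]; rfl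
  have hmul (p : ℚ) : f (4 * p) = σ (f p) := by
    rw [← isig, ← map_iSigma]; rfl
  have key (k : ℕ) : f (2 ^ k) < x := by
    induction k with
    | zero => simpa using h0
    | succ k ih =>
      -- From `2 ^ k < x`, applying `σ` gives `4 * 2 ^ k < 2x`, that is, `2 ^ (k + 1) < x`.
      by_contra! h
      have h2 := hσ ih
      rw [← hmul, hx, show (4 * 2 ^ k : ℚ) = 2 ^ (k + 1) + 2 ^ (k + 1) by ring, hadd] at h2
      exact absurd h2 (add_le_add h h).not_gt
  -- `2 ^ (2 * n) = 4 ^ n` is the upper bound assumed for `x`.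
  have := key (2 * n)
  rw [pow_mul] at this
  norm_num at this
  exact lt_asymm h1 this

theorem not_exists_isModelCompanionOf :
    ¬ ∃ T : langOGσ.Theory, T.IsModelCompanionOf odagσPlus := by
  rintro ⟨T, hT⟩
  obtain ⟨M, ⟨(g : ℚ ↪[langOGσ] M)⟩⟩ := hT.embeds_into (Theory.ModelType.of odagσPlus ℚ)
  obtain ⟨N, ⟨f⟩⟩ := hT.embeds_back M
  let u : Ultrafilter ℕ := Filter.hyperfilter ℕ
  let U := (u : Filter ℕ).Product fun _ => M
  have hU : U ⊨ T := ⟨fun ψ hψ => (Ultraproduct.sentence_realize ψ).2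
    (Filter.Eventually.of_forall fun _ => Theory.realize_sentence_of_mem T hψ)⟩
  let w : Fin 2 → ℕ → M := ![fun _ => g 1, fun n => g (4 ^ n)]
  let v : Fin 2 → U := fun i => (w i : U)
  have hnot : ¬ doubleBetween.Realize v := by
    intro h
    obtain ⟨n, hn⟩ := ((Ultraproduct.realize_formula_cast _ _).1 h).exists
    rw [realize_doubleBetween] at hn
    obtain ⟨x, h0, h1, hx⟩ := hn
    -- `M` is only known to model `T`, so the ordered group argument is run in `N`.
    refine not_double_between N (f.comp g) n (f x) ((map_iLt f _ _).2 h0) ((map_iLt f _ _).2 h1) ?_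
    rw [← map_iSigma, hx, map_iAdd]
  have hpos : posAndDoubled.Realize v := by
    refine (Ultraproduct.realize_formula_cast _ _).2 (Filter.Eventually.of_forall fun n => ?_)
    rw [realize_posAndDoubled]
    refine ⟨?_, ?_⟩
    · show iLt iZero (g 1)
      rw [← map_iZero g, map_iLt]
      show (0 : ℚ) < 1 - 0
      norm_num
    · show iLt (iAdd (g (4 ^ n)) (g (4 ^ n))) (iSigma (g (4 ^ n)))
      rw [← map_iAdd, ← map_iSigma, map_iLt]
      show (0 : ℚ) < 4 * 4 ^ n - (4 ^ n + 4 ^ n)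
      have : (0 : ℚ) < 4 ^ n := by positivity
      linarith
  have hlt (k : ℕ) : (iterateLt k).Realize v := by
    refine (Ultraproduct.realize_formula_cast _ _).2 ?_
    -- The ultrafilter is nonprincipal, so `σ^k 1 = 4 ^ k < 4 ^ n` for almost all `n`.
    have : ∀ᶠ n in (u : Filter ℕ), k < n :=
      Nat.hyperfilter_le_atTop (Filter.eventually_gt_atTop k)
    filter_upwards [this] with n hn
    rw [realize_iterateLt]
    show iLt (iSigma^[k] (g 1)) (g (4 ^ n))
    have hk : iSigma^[k] (g 1) = g (4 ^ k) := by
      clear hn this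
      induction k with
      | zero => simp
      | succ k ih =>
        rw [Function.iterate_succ_apply', ih, ← map_iSigma, pow_succ']
        rfl
    rw [hk, map_iLt]
    exact sub_pos.2 (pow_lt_pow_right₀ (by norm_num) hn)
  rw [realize_posAndDoubled] at hpos
  simp only [realize_iterateLt] at hlt
  obtain ⟨N₁, ⟨(f₁ : U ↪[langOGσ] N₁)⟩⟩ := hT.embeds_back (Theory.ModelType.of T U)
  obtain ⟨N₂, f₂, x, h0, h1, hx⟩ := exists_double_between N₁ (f₁ (v 0)) (f₁ (v 1))
    (by rw [← map_iZero f₁]; exact (map_iLt f₁ _ _).2 hpos.1)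
    (by rw [← map_iAdd, ← map_iSigma]; exact (map_iLt f₁ _ _).2 hpos.2)
    (fun n => by
      rw [← Function.Semiconj.iterate_right (map_iSigma f₁) n (v 0)]
      exact (map_iLt f₁ _ _).2 (hlt n))
  obtain ⟨M', ⟨f₃⟩⟩ := hT.embeds_into N₂
  refine hnot ((hT.isModelComplete (Theory.ModelType.of T U) M' (f₃.comp (f₂.comp f₁)) 2
    doubleBetween v).1 ?_)
  rw [realize_doubleBetween]
  exact ⟨f₃ x, (map_iLt f₃ _ _).2 h0, (map_iLt f₃ _ _).2 h1, by rw [← map_iSigma, hx, map_iAdd]⟩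

end OrderedDifferenceGroup

theorem theorem3p2 :
    ¬ ∃ T : OrderedDifferenceGroup.langOGσ.Theory,
      T.IsModelCompanionOf OrderedDifferenceGroup.odagσPlus :=
  OrderedDifferenceGroup.not_exists_isModelCompanionOf
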